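/- Let $G=(V,E)$ be a finite connected simple graph and let $\gamma:(0,\infty)\to(0,\infty)$ be Lipschitz on $[\delta,1]$ for every $\delta>0$. For positive edge weights $w=(w_e)_{e\in E}$ let $d=d_w$ be the weighted shortest-path distance on $V$, and for $\alpha\in[0,1]$ and $x\in V$ let $\mu_x^\alpha$ be the probability distribution on $V$ with $\mu_x^\alpha(x)=\alpha$, $\mu_x^\alpha(y)=(1-\alpha)\gamma(w_{xy})/\sum_{z\sim x}\gamma(w_{xz})$ for $y\sim x$, and $\mu_x^\alpha(y)=0$ otherwise. Let $W$ be the transportation distance between probability distributions on $V$ with cost $d$ (the infimum of $\sum_{x,y}A(x,y)d(x,y)$ over all couplings $A$), and let the Ollivier–Lin–Lu–Yau curvature of an edge $e=xy$ be $$\kappa_e=\lim_{\alpha\to1^-}\frac{1}{1-\alpha}\Big(1-\frac{W(\mu_x^\alpha,\mu_y^\alpha)}{d(x,y)}\Big).$$ Let $X_0\in\mathbb{R}^E$ have positive entries with sum $1$. A solution of the normalized Ricci flow on an interval $I\ni0$ is a differentiable curve $t\mapsto w(t)=(w_e(t))_{e\in E}$, $t\in I$, with all $w_e(t)>0$, $w(0)=X_0$,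 and $$\frac{dw_e}{dt}=-\kappa_e w_e+w_e\sum_{h\in E}\kappa_h w_h\qquad(e\in E,\ t\in I),$$ where $\kappa_e=\kappa_e(t)$ is the curvature for the weights $w(t)$ (the defining limits exist), and the derivative at $t=0$ is one-sided. Assume that the exit condition "$w_{uv}(t)>d_{w(t)}(u,v)$ for some edge $uv$" is never met: for every $T>0$, every solution on $[0,T)$ and every $t\in[0,T)$, each edge $uv$ satisfies $w_{uv}(t)\le d_{w(t)}(u,v)$, i.e. each edge is a shortest path between its endpoints. Then the normalized Ricci flow has a unique solution on $[0,\infty)$. -/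

import Mathlib

open Filter Topology Set

noncomputable section

namespace RicciFlow

variable {V : Type*} {G : SimpleGraph V}

/-- The length of a walk: the sum of the weights of its edges. -/
def walkLength (w : G.edgeSet → ℝ) : {x y : V} → G.Walk x y → ℝ
  | _, _, .nil => 0
  | _, _, .cons h p => w ⟨s(_, _), h⟩ + walkLength w p

/-- The weighted distance `d(x, y)`. For positive weights on a finite connected graph the infimum
over all walks is the minimum over all paths. -/
def wdist (w : G.edgeSet → ℝ) (x y : V) : ℝ :=
  sInf (Set.range fun p : G.Walk x y => walkLength w p)

open Classical in
/-- `γ (w_xy)` if `x ∼ y`, and `0` otherwise. -/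
def gammaWeight (γ : ℝ → ℝ) (w : G.edgeSet → ℝ) (x y : V) : ℝ :=
  if h : G.Adj x y then γ (w ⟨s(x, y), h⟩) else 0

variable [Fintype V]

open Classical in
/-- The distribution `μ_x^α`: mass `α` at `x`, and mass `(1 - α) γ(w_xy) / ∑_{z ∼ x} γ(w_xz)` at
each neighbour `y` of `x`. -/
def mu (γ : ℝ → ℝ) (w : G.edgeSet → ℝ) (α : ℝ) (x y : V) : ℝ :=
  if y = x then α else (1 - α) * (gammaWeight γ w x y / ∑ z, gammaWeight γ w x z)

/-- `A` is a coupling of the distributions `μ₁` and `μ₂` on the finite set `V` (its entries are then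
automatically at most `1`). -/
structure IsCoupling (μ₁ μ₂ : V → ℝ) (A : V → V → ℝ) : Prop where
  nonneg : ∀ x y, 0 ≤ A x y
  fst : ∀ x, ∑ y, A x y = μ₁ x
  snd : ∀ y, ∑ x, A x y = μ₂ y

/-- The transportation distance with respect to the cost `d`. -/
def transportDist (d : V → V → ℝ) (μ₁ μ₂ : V → ℝ) : ℝ :=
  sInf {c : ℝ | ∃ A : V → V → ℝ, IsCoupling μ₁ μ₂ A ∧ c = ∑ x, ∑ y, A x y * d x y}

/-- The `α`-Ricci curvature `κ_α(x, y) = 1 - W(μ_x^α, μ_y^α) / d(x, y)`. -/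
def alphaCurvature (γ : ℝ → ℝ) (w : G.edgeSet → ℝ) (α : ℝ) (x y : V) : ℝ :=
  1 - transportDist (wdist w) (mu γ w α x) (mu γ w α y) / wdist w x y

/-- `κ` is the Ollivier-Lin-Lu-Yau curvature of the edges: for each edge `xy` the limit
`κ_xy = lim_{α → 1} κ_α(x, y) / (1 - α)`, with `α < 1`, exists and has this value. -/
def IsCurvature (γ : ℝ → ℝ) (w κ : G.edgeSet → ℝ) : Prop :=
  ∀ (x y : V) (h : G.Adj x y),
    Tendsto (fun α : ℝ => alphaCurvature γ w α x y / (1 - α)) (𝓝[<] 1) (𝓝 (κ ⟨s(x, y), h⟩))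

/-- `X` solves the initial value problem of the normalized Ricci flow
`dw_e/dt = -κ_e w_e + w_e ∑_h κ_h w_h`, `w(0) = X₀`, on the interval `I` (which contains `0`), with
positive edge weights. At `t = 0` the derivative is one-sided. -/
structure IsRicciFlowOn [Fintype G.edgeSet] (γ : ℝ → ℝ) (X₀ : G.edgeSet → ℝ) (I : Set ℝ)
    (X : ℝ → G.edgeSet → ℝ) : Prop where
  init : X 0 = X₀
  pos : ∀ t ∈ I, ∀ e, 0 < X t e
  flow : ∃ κ : ℝ → G.edgeSet → ℝ, ∀ t ∈ I, IsCurvature γ (X t) (κ t) ∧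
    ∀ e, HasDerivWithinAt (fun s => X s e)
      (-(κ t e) * X t e + X t e * ∑ h, κ t h * X t h) I t

/-- The exit condition for the weights `w`: some edge is longer than the distance of its ends. -/
def ExitCondition (w : G.edgeSet → ℝ) : Prop :=
  ∃ (x y : V) (h : G.Adj x y), wdist w x y < w ⟨s(x, y), h⟩

end RicciFlow

end

/-!
For `α ≥ 1/2` every transport plan from `μ_x^α` to `μ_y^α` moves mass at least `2α - 1` from `x` to
`y`, so that `κ_α = 2 (1 - α) κ_{1/2}`: the limit defining `κ_e` is already attained at `α = 1/2`.
The curvature is therefore a Lipschitz function of the weights on every box `[δ, 1]^E` with `δ > 0`,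
and the flow is an ordinary differential equation of replicator type, which conserves the total
weight `1`. As `κ_e ≤ 2`, and `κ_e w_e ≥ -2 |V|` while no edge is longer than the distance of its
ends, the weights decay at most exponentially. Hence a solution stays in a compact box on every
bounded time interval, and exists for all time.
-/

namespace RicciFlow

section Transport

variable {V : Type*} [Fintype V] {μ ν μ' ν' : V → ℝ} {d d' A B : V → V → ℝ} {x y : V}

/-- The cost `∑ x, y, A x y * d x y` of a transport plan `A`, as a linear function of the plan. -/
noncomputable def transportCost (d : V → V → ℝ) : (V → V → ℝ) →ₗ[ℝ] ℝ where
  toFun A := ∑ x, ∑ y, A x y * d x y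
  map_add' A B := by simp only [Pi.add_apply, add_mul, Finset.sum_add_distrib]
  map_smul' c A := by
    simp only [Pi.smul_apply, smul_eq_mul, mul_assoc, Finset.mul_sum, RingHom.id_apply]

lemma transportCost_apply (d A : V → V → ℝ) : transportCost d A = ∑ x, ∑ y, A x y * d x y := rfl

namespace IsCoupling

lemma add (hA : IsCoupling μ ν A) (hB : IsCoupling μ' ν' B) :
    IsCoupling (μ + μ') (ν + ν') (A + B) where
  nonneg x y := add_nonneg (hA.nonneg x y) (hB.nonneg x y)
  fst x := by simp only [Pi.add_apply, Finset.sum_add_distrib, hA.fst, hB.fst]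
  snd y := by simp only [Pi.add_apply, Finset.sum_add_distrib, hA.snd, hB.snd]

lemma smul {c : ℝ} (hc : 0 ≤ c) (hA : IsCoupling μ ν A) :
    IsCoupling (c • μ) (c • ν) (c • A) where
  nonneg x y := mul_nonneg hc (hA.nonneg x y)
  fst x := by simp only [Pi.smul_apply, smul_eq_mul, ← Finset.mul_sum, hA.fst]
  snd y := by simp only [Pi.smul_apply, smul_eq_mul, ← Finset.mul_sum, hA.snd]

lemma sub (hA : IsCoupling μ ν A) (hB : IsCoupling μ' ν' B) (hBA : ∀ x y, B x y ≤ A x y) :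
    IsCoupling (μ - μ') (ν - ν') (A - B) where
  nonneg x y := sub_nonneg.2 (hBA x y)
  fst x := by simp only [Pi.sub_apply, Finset.sum_sub_distrib, hA.fst, hB.fst]
  snd y := by simp only [Pi.sub_apply, Finset.sum_sub_distrib, hA.snd, hB.snd]

lemma swap (hA : IsCoupling μ ν A) : IsCoupling ν μ (Function.swap A) where
  nonneg x y := hA.nonneg y x
  fst := hA.snd
  snd := hA.fst

lemma sum_eq_sum (hA : IsCoupling μ ν A) : ∑ x, μ x = ∑ y, ν y := by
  simp_rw [← hA.fst, ← hA.snd]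
  exact Finset.sum_comm

lemma le_snd (hA : IsCoupling μ ν A) (x y : V) : A x y ≤ ν y := by
  rw [← hA.snd]
  exact Finset.single_le_sum (fun x _ => hA.nonneg x y) (Finset.mem_univ x)

lemma fst_add_snd_le (hA : IsCoupling μ ν A) (x y : V) : μ x + ν y ≤ ∑ z, ν z + A x y := by
  classical
  have hrow : A x y + ∑ z ∈ Finset.univ.erase y, A x z = μ x := by
    rw [Finset.add_sum_erase _ _ (Finset.mem_univ y), hA.fst]
  have hν : ν y + ∑ z ∈ Finset.univ.erase y, ν z = ∑ z, ν z :=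
    Finset.add_sum_erase _ _ (Finset.mem_univ y)
  have hle := Finset.sum_le_sum fun z (_ : z ∈ Finset.univ.erase y) => hA.le_snd x z
  linarith

lemma transportCost_nonneg (hA : IsCoupling μ ν A) (hd : ∀ x y, 0 ≤ d x y) :
    0 ≤ transportCost d A :=
  Finset.sum_nonneg fun x _ => Finset.sum_nonneg fun y _ => mul_nonneg (hA.nonneg x y) (hd x y)

lemma transportCost_le_add {ε : ℝ} (hA : IsCoupling μ ν A) (hd : ∀ x y, d' x y ≤ d x y + ε) :
    transportCost d' A ≤ transportCost d A + ε * ∑ x, μ x := by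
  calc transportCost d' A ≤ ∑ x, ∑ y, A x y * (d x y + ε) := by
        simp only [transportCost_apply]
        gcongr with x _ y _
        exacts [hA.nonneg x y, hd x y]
    _ = transportCost d A + ε * ∑ x, μ x := by
        simp_rw [transportCost_apply, mul_add, Finset.sum_add_distrib, ← Finset.sum_mul, hA.fst,
          mul_comm]

lemma transportCost_le {D : ℝ} (hA : IsCoupling μ ν A) (hd : ∀ x y, d x y ≤ D) :
    transportCost d A ≤ D * ∑ x, μ x := by
  simpa [transportCost_apply] using
    hA.transportCost_le_add (d := fun _ _ => 0) (d' := d) (by simpa using hd)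

end IsCoupling

lemma exists_isCoupling (hμ : ∀ x, 0 ≤ μ x) (hν : ∀ x, 0 ≤ ν x) (h : ∑ x, μ x = ∑ x, ν x) :
    ∃ A, IsCoupling μ ν A := by
  have hfst : ∀ {μ ν : V → ℝ}, (∀ x, 0 ≤ μ x) → ∑ x, μ x = ∑ x, ν x →
      ∀ x, μ x * ∑ y, ν y / ∑ z, μ z = μ x := by
    intro μ ν hμ h x
    rw [← Finset.sum_div, ← h, ← mul_div_assoc]
    -- If the total mass is `0`, then so is `μ x`.
    refine mul_div_cancel_of_imp fun h0 => ?_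
    exact (Finset.sum_eq_zero_iff_of_nonneg fun x _ => hμ x).1 h0 x (Finset.mem_univ x)
  refine ⟨fun x y => μ x * (ν y / ∑ z, μ z), fun x y => ?_, fun x => ?_, fun y => ?_⟩
  · exact mul_nonneg (hμ x) (div_nonneg (hν y) (Finset.sum_nonneg fun z _ => hμ z))
  · rw [← Finset.mul_sum, hfst hμ h]
  · simp_rw [← mul_div_assoc, mul_comm (μ _), mul_div_assoc, ← Finset.mul_sum, h]
    exact hfst hν h.symm y

lemma transportDist_le (hd : ∀ x y, 0 ≤ d x y) (hA : IsCoupling μ ν A) :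
    transportDist d μ ν ≤ transportCost d A := by
  refine csInf_le ⟨0, ?_⟩ ⟨A, hA, rfl⟩
  rintro _ ⟨B, hB, rfl⟩
  exact hB.transportCost_nonneg hd

lemma le_transportDist (hμ : μ ∈ stdSimplex ℝ V) (hν : ν ∈ stdSimplex ℝ V) {c : ℝ}
    (h : ∀ A, IsCoupling μ ν A → c ≤ transportCost d A) : c ≤ transportDist d μ ν := by
  obtain ⟨A, hA⟩ := exists_isCoupling hμ.1 hν.1 (hμ.2.trans hν.2.symm)
  refine le_csInf ⟨_, A, hA, rfl⟩ ?_
  rintro _ ⟨B, hB, rfl⟩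
  exact h B hB

lemma transportDist_nonneg (hd : ∀ x y, 0 ≤ d x y) (hμ : μ ∈ stdSimplex ℝ V)
    (hν : ν ∈ stdSimplex ℝ V) : 0 ≤ transportDist d μ ν :=
  le_transportDist hμ hν fun _ hA => hA.transportCost_nonneg hd

lemma transportDist_le_of_forall_le {D : ℝ} (hd : ∀ x y, d x y ∈ Icc 0 D)
    (hμ : μ ∈ stdSimplex ℝ V) (hν : ν ∈ stdSimplex ℝ V) : transportDist d μ ν ≤ D := by
  obtain ⟨A, hA⟩ := exists_isCoupling hμ.1 hν.1 (hμ.2.trans hν.2.symm)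
  calc transportDist d μ ν ≤ transportCost d A := transportDist_le (fun x y => (hd x y).1) hA
    _ ≤ D * ∑ x, μ x := hA.transportCost_le fun x y => (hd x y).2
    _ = D := by rw [hμ.2, mul_one]

lemma transportDist_swap (d : V → V → ℝ) (μ ν : V → ℝ) :
    transportDist (Function.swap d) ν μ = transportDist d μ ν := by
  unfold transportDist
  congr 1
  ext c
  constructor <;>
  · rintro ⟨A, hA, rfl⟩
    exact ⟨_, hA.swap, Finset.sum_comm⟩

lemma transportDist_le_add_of_le {ε : ℝ} (hd' : ∀ x y, 0 ≤ d' x y)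
    (hd : ∀ x y, d' x y ≤ d x y + ε) (hμ : μ ∈ stdSimplex ℝ V) (hν : ν ∈ stdSimplex ℝ V) :
    transportDist d' μ ν ≤ transportDist d μ ν + ε := by
  refine sub_le_iff_le_add.1 (le_transportDist hμ hν fun A hA => ?_)
  have := (transportDist_le hd' hA).trans (hA.transportCost_le_add hd)
  rw [hμ.2, mul_one] at this
  linarith

lemma transportDist_le_transportCost_add {D : ℝ} {p q : V → ℝ} (hd : ∀ x y, d x y ∈ Icc 0 D)
    (hA : IsCoupling p q A) (hp : ∀ x, p x ≤ μ x) (hq : ∀ x, q x ≤ ν x)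
    (h : ∑ x, μ x = ∑ x, ν x) :
    transportDist d μ ν ≤ transportCost d A + D * ∑ x, (μ x - p x) := by
  obtain ⟨B, hB⟩ := exists_isCoupling (μ := μ - p) (ν := ν - q) (fun x => sub_nonneg.2 (hp x))
    (fun x => sub_nonneg.2 (hq x)) (by simp [h, hA.sum_eq_sum])
  have hAB := hA.add hB
  rw [add_sub_cancel, add_sub_cancel] at hAB
  calc transportDist d μ ν ≤ transportCost d (A + B) :=
        transportDist_le (fun x y => (hd x y).1) hAB
    _ ≤ transportCost d A + D * ∑ x, (μ x - p x) := by
        rw [map_add]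
        exact add_le_add_right (hB.transportCost_le fun x y => (hd x y).2) _

lemma transportDist_le_add_sum_abs_left {D : ℝ} (hd : ∀ x y, d x y ∈ Icc 0 D)
    (hμ : μ ∈ stdSimplex ℝ V) (hμ' : μ' ∈ stdSimplex ℝ V) (hν : ν ∈ stdSimplex ℝ V) :
    transportDist d μ' ν ≤ transportDist d μ ν + D * ∑ x, |μ' x - μ x| := by
  refine sub_le_iff_le_add.1 (le_transportDist hμ hν fun A hA => sub_le_iff_le_add.2 ?_)
  -- Scaling the row of `x` by `a x` leaves the part of the plan `A` that `μ'` can still follow.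
  set a : V → ℝ := fun x => min (μ x) (μ' x) / μ x
  have ha1 : ∀ x, a x ≤ 1 := fun x => div_le_one_of_le₀ (min_le_left _ _) (hμ.1 x)
  have ha0 : ∀ x, 0 ≤ a x := fun x => div_nonneg (le_min (hμ.1 x) (hμ'.1 x)) (hμ.1 x)
  have haμ : ∀ x, a x * μ x = min (μ x) (μ' x) := fun x =>
    div_mul_cancel_of_imp fun h => by rw [h, min_eq_left (hμ'.1 x)]
  have haA : ∀ x y, a x * A x y ≤ A x y := fun x y =>
    mul_le_of_le_one_left (hA.nonneg x y) (ha1 x)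
  have hP : IsCoupling (fun x => min (μ x) (μ' x)) (fun y => ∑ x, a x * A x y)
      (fun x y => a x * A x y) :=
    ⟨fun x y => mul_nonneg (ha0 x) (hA.nonneg x y),
      fun x => by rw [← Finset.mul_sum, hA.fst, haμ], fun _ => rfl⟩
  calc transportDist d μ' ν
      ≤ transportCost d (fun x y => a x * A x y) + D * ∑ x, (μ' x - min (μ x) (μ' x)) := by
        refine transportDist_le_transportCost_add hd hP (fun x => min_le_right _ _) (fun y => ?_)
          (hμ'.2.trans hν.2.symm)
        rw [← hA.snd]
        exact Finset.sum_le_sum fun x _ => haA x y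
    _ ≤ transportCost d A + D * ∑ x, |μ' x - μ x| := by
        simp only [transportCost_apply, Finset.mul_sum]
        gcongr with x _ y _ x _
        · exact (hd x y).1
        · exact haA x y
        · exact (hd x x).1.trans (hd x x).2
        · rcases min_cases (μ x) (μ' x) with ⟨h, -⟩ | ⟨h, -⟩ <;> rw [h]
          · exact le_abs_self _
          · simp

lemma transportDist_le_add_sum_abs {D : ℝ} (hd : ∀ x y, d x y ∈ Icc 0 D)
    (hμ : μ ∈ stdSimplex ℝ V) (hμ' : μ' ∈ stdSimplex ℝ V) (hν : ν ∈ stdSimplex ℝ V)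
    (hν' : ν' ∈ stdSimplex ℝ V) :
    transportDist d μ' ν' ≤
      transportDist d μ ν + D * (∑ x, |μ' x - μ x| + ∑ x, |ν' x - ν x|) := by
  have hfst := transportDist_le_add_sum_abs_left hd hμ hμ' hν'
  have hsnd := transportDist_le_add_sum_abs_left
    (show ∀ x y, Function.swap d x y ∈ Icc 0 D from fun x y => hd y x) hν hν' hμ
  rw [transportDist_swap d μ ν', transportDist_swap d μ ν] at hsnd
  linarith

lemma lipschitzOnWith_transportDist (D : NNReal) :
    LipschitzOnWith (1 + 2 * (D * Fintype.card V))
      (fun q : (V → V → ℝ) × (V → ℝ) × (V → ℝ) => transportDist q.1 q.2.1 q.2.2)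
      ({d | ∀ x y, d x y ∈ Icc 0 (D : ℝ)} ×ˢ stdSimplex ℝ V ×ˢ stdSimplex ℝ V) := by
  refine LipschitzOnWith.of_le_add_mul _ ?_
  rintro ⟨d', μ', ν'⟩ ⟨hd', hμ', hν'⟩ ⟨d, μ, ν⟩ ⟨hd, hμ, hν⟩
  simp only at hd hμ hν hd' hμ' hν' ⊢
  set r := dist (d', μ', ν') (d, μ, ν) with hr
  have hdist : dist d' d ≤ r ∧ dist μ' μ ≤ r ∧ dist ν' ν ≤ r := by
    simp [hr, Prod.dist_eq]
  have hdd : ∀ x y, d' x y ≤ d x y + r := fun x y => by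
    have := (dist_le_pi_dist _ _ y).trans ((dist_le_pi_dist d' d x).trans hdist.1)
    linarith [le_abs_self (d' x y - d x y), Real.dist_eq (d' x y) (d x y)]
  have hsum : ∀ {μ μ' : V → ℝ}, dist μ' μ ≤ r → ∑ x, |μ' x - μ x| ≤ Fintype.card V * r :=
    fun {μ μ'} h => by
      simpa [Real.dist_eq] using Finset.sum_le_sum
        fun x (_ : x ∈ Finset.univ) => (dist_le_pi_dist μ' μ x).trans h
  calc transportDist d' μ' ν'
      ≤ transportDist d' μ ν + D * (∑ x, |μ' x - μ x| + ∑ x, |ν' x - ν x|) :=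
        transportDist_le_add_sum_abs hd' hμ hμ' hν hν'
    _ ≤ (transportDist d μ ν + r) + D * (Fintype.card V * r + Fintype.card V * r) := by
        gcongr
        · exact transportDist_le_add_of_le (fun x y => (hd' x y).1) hdd hμ hν
        · exact hsum hdist.2.1
        · exact hsum hdist.2.2
    _ = transportDist d μ ν + ↑(1 + 2 * (D * (Fintype.card V : NNReal))) * r := by
        push_cast
        ring

section Dirac

variable [DecidableEq V]

lemma isCoupling_single (x y : V) :
    IsCoupling (Pi.single x 1) (Pi.single y 1) (Pi.single x (Pi.single y 1)) where
  nonneg a b := by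
    obtain rfl | ha := eq_or_ne a x
    · obtain rfl | hb := eq_or_ne b y <;> simp [*]
    · simp [ha]
  fst a := by obtain rfl | ha := eq_or_ne a x <;> simp [*]
  snd b := by rw [Finset.sum_eq_single x] <;> simp +contextual

lemma transportCost_single (d : V → V → ℝ) (x y : V) :
    transportCost d (Pi.single x (Pi.single y 1)) = d x y := by
  rw [transportCost_apply, Finset.sum_eq_single x, Finset.sum_eq_single y] <;>
    simp +contextual

/-- If `μ x + ν y ≥ 1`, then every transport plan between the two mixtures moves mass at least
`1 - s` from `x` to `y`. -/
lemma transportDist_mix_single (hd : ∀ x y, 0 ≤ d x y) (hμ : μ ∈ stdSimplex ℝ V)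
    (hν : ν ∈ stdSimplex ℝ V) (hxy : 1 ≤ μ x + ν y) {s : ℝ} (hs : s ∈ Ioc 0 1) :
    transportDist d (s • μ + (1 - s) • Pi.single x 1) (s • ν + (1 - s) • Pi.single y 1) =
      s * transportDist d μ ν + (1 - s) * d x y := by
  have h1s : 0 ≤ 1 - s := sub_nonneg.2 hs.2
  have hmix : ∀ {μ : V → ℝ} (x : V), μ ∈ stdSimplex ℝ V →
      s • μ + (1 - s) • Pi.single x 1 ∈ stdSimplex ℝ V := fun x hμ =>
    convex_stdSimplex ℝ V hμ (single_mem_stdSimplex ℝ x) hs.1.le h1s (by ring)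
  have hδ := (isCoupling_single x y).smul h1s
  have hδcost : transportCost d ((1 - s) • Pi.single x (Pi.single y 1)) = (1 - s) * d x y := by
    rw [map_smul, transportCost_single, smul_eq_mul]
  apply le_antisymm
  · rw [← sub_le_iff_le_add, ← div_le_iff₀' hs.1]
    refine le_transportDist hμ hν fun A hA => ?_
    rw [div_le_iff₀' hs.1, sub_le_iff_le_add, ← hδcost, ← smul_eq_mul, ← map_smul, ← map_add]
    exact transportDist_le hd ((hA.smul hs.1.le).add hδ)
  · refine le_transportDist (hmix x hμ) (hmix y hν) fun A hA => ?_
    have hAxy : 1 - s ≤ A x y := by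
      have := hA.fst_add_snd_le x y
      rw [(hmix y hν).2] at this
      simp only [Pi.add_apply, Pi.smul_apply, Pi.single_eq_same, smul_eq_mul] at this
      nlinarith [hs.1]
    have hle : ∀ a b, ((1 - s) • Pi.single x (Pi.single y 1) : V → V → ℝ) a b ≤ A a b := by
      intro a b
      obtain rfl | ha := eq_or_ne a x
      · obtain rfl | hb := eq_or_ne b y
        · simpa using hAxy
        · simpa [hb] using hA.nonneg a b
      · simpa [ha] using hA.nonneg a b
    have hB := (hA.sub hδ hle).smul (inv_nonneg.2 hs.1.le)
    rw [add_sub_cancel_right, add_sub_cancel_right, inv_smul_smul₀ hs.1.ne',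
      inv_smul_smul₀ hs.1.ne'] at hB
    have := transportDist_le hd hB
    rwa [map_smul, map_sub, hδcost, smul_eq_mul, le_inv_mul_iff₀ hs.1, le_sub_iff_add_le] at this

end Dirac

end Transport

section Distance

variable {V : Type*} {G : SimpleGraph V} {w w' : G.edgeSet → ℝ} {x y z : V}

lemma walkLength_nonneg (hw : ∀ e, 0 ≤ w e) (p : G.Walk x y) : 0 ≤ walkLength w p := by
  induction p with
  | nil => exact le_rfl
  | cons h p ih => exact add_nonneg (hw _) ih

lemma walkLength_le_mul {c : ℝ} (h : ∀ e, w' e ≤ c * w e) (p : G.Walk x y) :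
    walkLength w' p ≤ c * walkLength w p := by
  induction p with
  | nil => simp [walkLength]
  | cons _ p ih =>
    simp only [walkLength, mul_add]
    exact add_le_add (h _) ih

lemma walkLength_le_mul_length {M : ℝ} (h : ∀ e, w e ≤ M) (p : G.Walk x y) :
    walkLength w p ≤ M * p.length := by
  induction p with
  | nil => simp [walkLength]
  | cons _ p ih =>
    rw [walkLength, SimpleGraph.Walk.length_cons, Nat.cast_add_one]
    linarith [h ⟨s(_, _), ‹_›⟩]

lemma walkLength_append (w : G.edgeSet → ℝ) (p : G.Walk x y) (q : G.Walk y z) :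
    walkLength w (p.append q) = walkLength w p + walkLength w q := by
  induction p with
  | nil => simp [walkLength]
  | cons h p ih => simp [walkLength, ih, add_assoc]

lemma walkLength_reverse (w : G.edgeSet → ℝ) (p : G.Walk x y) :
    walkLength w p.reverse = walkLength w p := by
  induction p with
  | nil => rfl
  | cons h p ih => simp [walkLength, walkLength_append, ih, Sym2.eq_swap, add_comm]

lemma wdist_comm (w : G.edgeSet → ℝ) (x y : V) : wdist w x y = wdist w y x := by
  unfold wdist
  congr 1
  ext c
  constructor <;> rintro ⟨p, rfl⟩ <;> exact ⟨p.reverse, walkLength_reverse w p⟩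

lemma wdist_le (hw : ∀ e, 0 ≤ w e) (p : G.Walk x y) : wdist w x y ≤ walkLength w p := by
  refine csInf_le ⟨0, ?_⟩ ⟨p, rfl⟩
  rintro _ ⟨q, rfl⟩
  exact walkLength_nonneg hw q

lemma wdist_le_weight (hw : ∀ e, 0 ≤ w e) (h : G.Adj x y) : wdist w x y ≤ w ⟨s(x, y), h⟩ := by
  simpa [walkLength] using wdist_le hw (.cons h .nil)

lemma le_wdist (hG : G.Connected) {c : ℝ} (h : ∀ p : G.Walk x y, c ≤ walkLength w p) :
    c ≤ wdist w x y := by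
  obtain ⟨p⟩ := hG.preconnected x y
  refine le_csInf ⟨_, p, rfl⟩ ?_
  rintro _ ⟨q, rfl⟩
  exact h q

lemma wdist_nonneg (hG : G.Connected) (hw : ∀ e, 0 ≤ w e) (x y : V) : 0 ≤ wdist w x y :=
  le_wdist hG fun p => walkLength_nonneg hw p

lemma le_wdist_of_ne (hG : G.Connected) {δ : ℝ} (hδ : 0 ≤ δ) (hw : ∀ e, δ ≤ w e) (hxy : x ≠ y) :
    δ ≤ wdist w x y := by
  refine le_wdist hG fun p => ?_
  cases p with
  | nil => exact absurd rfl hxy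
  | cons h p =>
    exact le_add_of_le_of_nonneg (hw _) (walkLength_nonneg (fun e => hδ.trans (hw e)) p)

lemma wdist_pos [Finite G.edgeSet] (hG : G.Connected) (hw : ∀ e, 0 < w e) (hxy : G.Adj x y) :
    0 < wdist w x y := by
  have : Nonempty G.edgeSet := ⟨⟨s(x, y), hxy⟩⟩
  obtain ⟨e, he⟩ := Finite.exists_min w
  exact (hw e).trans_le (le_wdist_of_ne hG (hw e).le he hxy.ne)

lemma wdist_le_mul (hG : G.Connected) {c : ℝ} (hc : 0 < c) (hw' : ∀ e, 0 ≤ w' e)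
    (h : ∀ e, w' e ≤ c * w e) (x y : V) : wdist w' x y ≤ c * wdist w x y := by
  rw [← div_le_iff₀' hc]
  refine le_wdist hG fun p => ?_
  rw [div_le_iff₀' hc]
  exact (wdist_le hw' p).trans (walkLength_le_mul h p)

lemma wdist_mem_Icc [Fintype V] (hG : G.Connected) {M : ℝ} (hM : 0 ≤ M)
    (hw : ∀ e, w e ∈ Icc 0 M) (x y : V) : wdist w x y ∈ Icc 0 (M * Fintype.card V) := by
  refine ⟨wdist_nonneg hG (fun e => (hw e).1) x y, ?_⟩
  obtain ⟨p, hp⟩ := hG.preconnected.exists_isPath x y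
  calc wdist w x y ≤ walkLength w p := wdist_le (fun e => (hw e).1) p
    _ ≤ M * p.length := walkLength_le_mul_length (fun e => (hw e).2) p
    _ ≤ M * Fintype.card V := by
        gcongr
        exact hp.length_lt.le

end Distance

section Curvature

variable {V : Type*} {G : SimpleGraph V} {γ : ℝ → ℝ} {w : G.edgeSet → ℝ} {x y : V}

@[elab_as_elim]
lemma edgeSet_induction {motive : G.edgeSet → Prop}
    (mk : ∀ x y (hxy : G.Adj x y), motive ⟨s(x, y), hxy⟩) (e : G.edgeSet) : motive e := by
  obtain ⟨⟨x, y⟩, hxy⟩ := e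
  exact mk x y hxy

lemma gammaWeight_nonneg (hγ : ∀ e, 0 < γ (w e)) (x y : V) : 0 ≤ gammaWeight γ w x y := by
  unfold gammaWeight
  split_ifs
  exacts [(hγ _).le, le_rfl]

variable [Fintype V]

lemma sum_gammaWeight_pos (hγ : ∀ e, 0 < γ (w e)) (h : G.Adj x y) :
    0 < ∑ z, gammaWeight γ w x z :=
  Finset.sum_pos' (fun z _ => gammaWeight_nonneg hγ x z)
    ⟨y, Finset.mem_univ y, by simpa [gammaWeight, h] using hγ _⟩

lemma mu_zero (γ : ℝ → ℝ) (w : G.edgeSet → ℝ) (x : V) :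
    mu γ w 0 x = fun y => gammaWeight γ w x y / ∑ z, gammaWeight γ w x z := by
  funext y
  obtain rfl | hy := eq_or_ne y x <;> simp [mu, gammaWeight, *]

lemma mu_eq_add [DecidableEq V] (γ : ℝ → ℝ) (w : G.edgeSet → ℝ) (α : ℝ) (x : V) :
    mu γ w α x = α • Pi.single x 1 + (1 - α) • mu γ w 0 x := by
  funext y
  obtain rfl | hy := eq_or_ne y x <;> simp [mu, *]

lemma mu_mem_stdSimplex (hγ : ∀ e, 0 < γ (w e)) (h : G.Adj x y) {α : ℝ} (hα : α ∈ Icc 0 1) :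
    mu γ w α x ∈ stdSimplex ℝ V := by
  classical
  have hS := sum_gammaWeight_pos hγ h
  have hmu0 : mu γ w 0 x ∈ stdSimplex ℝ V := by
    rw [mu_zero]
    exact ⟨fun z => div_nonneg (gammaWeight_nonneg hγ x z) hS.le,
      by rw [← Finset.sum_div, div_self hS.ne']⟩
  rw [mu_eq_add]
  exact convex_stdSimplex ℝ V (single_mem_stdSimplex ℝ x) hmu0 hα.1 (sub_nonneg.2 hα.2) (by ring)

lemma alphaCurvature_comm (γ : ℝ → ℝ) (w : G.edgeSet → ℝ) (α : ℝ) (x y : V) :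
    alphaCurvature γ w α x y = alphaCurvature γ w α y x := by
  have hswap : Function.swap (wdist w) = wdist w := by
    funext a b
    exact wdist_comm w b a
  rw [alphaCurvature, ← transportDist_swap, hswap, wdist_comm w x y, alphaCurvature]

/-- The curvature of an edge in the closed form `2 κ_{1/2}`, which equals the limit defining it
because `κ_α` is proportional to `1 - α` for `α ≥ 1/2`. -/
noncomputable def curvature (γ : ℝ → ℝ) (w : G.edgeSet → ℝ) (e : G.edgeSet) : ℝ :=
  2 * Sym2.lift ⟨alphaCurvature γ w (1 / 2), alphaCurvature_comm γ w (1 / 2)⟩ e.1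

lemma curvature_mk (γ : ℝ → ℝ) (w : G.edgeSet → ℝ) (h : G.Adj x y) :
    curvature γ w ⟨s(x, y), h⟩ = 2 * alphaCurvature γ w (1 / 2) x y := rfl

lemma alphaCurvature_one_sub_half (hG : G.Connected) (hw : ∀ e, 0 ≤ w e) (hγ : ∀ e, 0 < γ (w e))
    (h : G.Adj x y) (hxy : wdist w x y ≠ 0) {s : ℝ} (hs : s ∈ Ioc 0 1) :
    alphaCurvature γ w (1 - s / 2) x y = s * alphaCurvature γ w (1 / 2) x y := by
  classical
  have hmix : ∀ x, mu γ w (1 - s / 2) x = s • mu γ w (1 / 2) x + (1 - s) • Pi.single x 1 :=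
    fun x => by
      rw [mu_eq_add γ w (1 - s / 2), mu_eq_add γ w (1 / 2)]
      module
  have hhalf : (1 / 2 : ℝ) ∈ Icc 0 1 := by norm_num
  rw [alphaCurvature, hmix, hmix, transportDist_mix_single (wdist_nonneg hG hw)
    (mu_mem_stdSimplex hγ h hhalf) (mu_mem_stdSimplex hγ h.symm hhalf) (by simp [mu]; norm_num) hs,
    alphaCurvature]
  field_simp
  ring

lemma curvature_le_two (hG : G.Connected) (hw : ∀ e, 0 ≤ w e) (hγ : ∀ e, 0 < γ (w e))
    (e : G.edgeSet) : curvature γ w e ≤ 2 := by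
  induction e using edgeSet_induction with
  | mk x y h =>
    have hhalf : (1 / 2 : ℝ) ∈ Icc 0 1 := by norm_num
    have := div_nonneg (transportDist_nonneg (wdist_nonneg hG hw) (mu_mem_stdSimplex hγ h hhalf)
      (mu_mem_stdSimplex hγ h.symm hhalf)) (wdist_nonneg hG hw x y)
    rw [curvature_mk, alphaCurvature]
    linarith

variable [Finite G.edgeSet]

lemma tendsto_alphaCurvature (hG : G.Connected) (hw : ∀ e, 0 < w e) (hγ : ∀ e, 0 < γ (w e))
    (h : G.Adj x y) :
    Tendsto (fun α => alphaCurvature γ w α x y / (1 - α)) (𝓝[<] 1)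
      (𝓝 (curvature γ w ⟨s(x, y), h⟩)) := by
  refine tendsto_const_nhds.congr' ?_
  filter_upwards [Ioo_mem_nhdsLT (show (1 / 2 : ℝ) < 1 by norm_num)] with α hα
  have hα1 : 1 - α ≠ 0 := by linarith [hα.2]
  have := alphaCurvature_one_sub_half hG (fun e => (hw e).le) hγ h (wdist_pos hG hw h).ne'
    (s := 2 * (1 - α)) ⟨by linarith [hα.2], by linarith [hα.1]⟩
  rw [show 1 - 2 * (1 - α) / 2 = α by ring] at this
  rw [curvature_mk, this]
  field_simp

lemma isCurvature_iff (hG : G.Connected) (hw : ∀ e, 0 < w e) (hγ : ∀ e, 0 < γ (w e))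
    {κ : G.edgeSet → ℝ} : IsCurvature γ w κ ↔ κ = curvature γ w := by
  constructor
  · intro h
    funext e
    induction e using edgeSet_induction with
    | mk x y hxy => exact tendsto_nhds_unique (h x y hxy) (tendsto_alphaCurvature hG hw hγ hxy)
  · rintro rfl x y h
    exact tendsto_alphaCurvature hG hw hγ h

lemma neg_le_curvature_mul (hG : G.Connected) (hγ : ∀ e, 0 < γ (w e)) {M : ℝ}
    (hw : ∀ e, w e ∈ Ioc 0 M) (hexit : ¬ ExitCondition w) (e : G.edgeSet) :
    -(2 * (M * Fintype.card V)) ≤ curvature γ w e * w e := by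
  induction e using edgeSet_induction with
  | mk x y h =>
    have hpos := wdist_pos hG (fun e => (hw e).1) h
    have hd : w ⟨s(x, y), h⟩ = wdist w x y :=
      le_antisymm (not_lt.1 fun hlt => hexit ⟨x, y, h, hlt⟩)
        (wdist_le_weight (fun e => (hw e).1.le) h)
    have hM : 0 ≤ M := (hw ⟨s(x, y), h⟩).1.le.trans (hw _).2
    have hhalf : (1 / 2 : ℝ) ∈ Icc 0 1 := by norm_num
    have hW := transportDist_le_of_forall_le
      (wdist_mem_Icc hG hM fun e => Ioc_subset_Icc_self (hw e)) (mu_mem_stdSimplex hγ h hhalf)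
      (mu_mem_stdSimplex hγ h.symm hhalf)
    calc -(2 * (M * Fintype.card V))
        ≤ 2 * (wdist w x y - transportDist (wdist w) (mu γ w (1 / 2) x) (mu γ w (1 / 2) y)) := by
          linarith
      _ = curvature γ w ⟨s(x, y), h⟩ * w ⟨s(x, y), h⟩ := by
          rw [curvature_mk, alphaCurvature, hd]
          field_simp

end Curvature

section Lipschitz

section Composition

variable {α ι E F : Type*} [PseudoMetricSpace α] [NormedAddCommGroup E] [NormedSpace ℝ E]
  [NormedAddCommGroup F] [NormedSpace ℝ F] {s : Set α}

lemma exists_lipschitzOnWith_pi [Fintype ι] {X : ι → Type*} [∀ i, PseudoMetricSpace (X i)]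
    {f : α → ∀ i, X i} (hf : ∀ i, ∃ K, LipschitzOnWith K (fun a => f a i) s) :
    ∃ K, LipschitzOnWith K f s := by
  choose K hK using hf
  refine ⟨Finset.univ.sup K, fun a ha b hb => edist_pi_le_iff.2 fun i => ?_⟩
  exact (hK i).weaken (Finset.le_sup (Finset.mem_univ i)) ha hb

lemma exists_lipschitzOnWith_comp {f : α → E} {g : E → F} {K : NNReal} (hs : IsCompact s)
    (hf : LipschitzOnWith K f s) (hg : ∀ a ∈ s, ContDiffAt ℝ 1 g (f a)) :
    ∃ K', LipschitzOnWith K' (fun a => g (f a)) s := by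
  refine LocallyLipschitzOn.exists_lipschitzOnWith_of_compact hs fun a ha => ?_
  obtain ⟨K', t, ht, hgt⟩ := (hg a ha).exists_lipschitzOnWith
  exact ⟨K' * K, s ∩ f ⁻¹' t,
    inter_mem self_mem_nhdsWithin (hf.continuousOn.continuousWithinAt ha ht),
    hgt.comp (hf.mono inter_subset_left) fun _ hb => hb.2⟩

end Composition

variable {V : Type*} [Fintype V] {G : SimpleGraph V} [Fintype G.edgeSet] {γ : ℝ → ℝ} {δ M : ℝ}

lemma exists_lipschitzOnWith_wdist (hG : G.Connected) (hδ : 0 < δ) (hM : 0 ≤ M) :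
    ∃ K, LipschitzOnWith K (wdist (G := G)) (Icc (fun _ => δ) fun _ => M) := by
  refine exists_lipschitzOnWith_pi fun x => exists_lipschitzOnWith_pi fun y =>
    ⟨_, LipschitzOnWith.of_le_add_mul' (M * Fintype.card V / δ) fun w' hw' w hw => ?_⟩
  have hw'w : ∀ e, w' e ≤ (1 + dist w' w / δ) * w e := fun e => by
    have hdist : w' e - w e ≤ dist w' w := (le_abs_self _).trans (dist_le_pi_dist w' w e)
    have hwe : dist w' w ≤ dist w' w / δ * w e := by
      rw [div_mul_eq_mul_div, le_div_iff₀ hδ]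
      exact mul_le_mul_of_nonneg_left (hw.1 e) dist_nonneg
    linarith
  calc wdist w' x y
      ≤ (1 + dist w' w / δ) * wdist w x y :=
        wdist_le_mul hG (by positivity) (fun e => hδ.le.trans (hw'.1 e)) hw'w x y
    _ = wdist w x y + wdist w x y / δ * dist w' w := by ring
    _ ≤ wdist w x y + M * Fintype.card V / δ * dist w' w := by
        gcongr
        exact (wdist_mem_Icc hG hM (fun e => ⟨hδ.le.trans (hw.1 e), hw.2 e⟩) x y).2

lemma exists_lipschitzOnWith_mu {K : NNReal}
    (hγ_lip : LipschitzOnWith K γ (Icc δ M)) (hγ : ∀ r ∈ Icc δ M, 0 < γ r) (α : ℝ) {x y : V}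
    (h : G.Adj x y) :
    ∃ K', LipschitzOnWith K' (fun w : G.edgeSet → ℝ => mu γ w α x)
      (Icc (fun _ => δ) fun _ => M) := by
  have hweight : ∃ K, LipschitzOnWith K (fun w : G.edgeSet → ℝ => gammaWeight γ w x)
      (Icc (fun _ => δ) fun _ => M) := by
    refine exists_lipschitzOnWith_pi fun z => ?_
    by_cases hz : G.Adj x z
    · simp only [gammaWeight, hz, dite_true]
      exact ⟨_, hγ_lip.comp (LipschitzWith.eval _).lipschitzOnWith fun w hw => ⟨hw.1 _, hw.2 _⟩⟩
    · simp only [gammaWeight, hz, dite_false]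
      exact ⟨_, (LipschitzWith.const _).lipschitzOnWith⟩
  obtain ⟨L, hL⟩ := hweight
  refine exists_lipschitzOnWith_pi fun z => ?_
  unfold mu
  split_ifs with hz
  · exact ⟨_, (LipschitzWith.const _).lipschitzOnWith⟩
  · refine exists_lipschitzOnWith_comp
      (g := fun v : V → ℝ => (1 - α) * (v z / ∑ z, v z)) isCompact_Icc hL fun w hw => ?_
    have hS := sum_gammaWeight_pos (fun e => hγ (w e) ⟨hw.1 e, hw.2 e⟩) h
    exact contDiffAt_const.mul (ContDiffAt.div (by fun_prop) (by fun_prop) hS.ne')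

lemma exists_lipschitzOnWith_curvature (hG : G.Connected) (hδ : 0 < δ) (hM : 0 ≤ M)
    {K : NNReal} (hγ_lip : LipschitzOnWith K γ (Icc δ M)) (hγ : ∀ r ∈ Icc δ M, 0 < γ r) :
    ∃ K', LipschitzOnWith K' (curvature (G := G) γ) (Icc (fun _ => δ) fun _ => M) := by
  refine exists_lipschitzOnWith_pi fun e => ?_
  induction e using edgeSet_induction with
  | mk x y h =>
    obtain ⟨L, hL⟩ := exists_lipschitzOnWith_wdist hG hδ hM
    obtain ⟨Lx, hLx⟩ := exists_lipschitzOnWith_mu hγ_lip hγ (1 / 2) h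
    obtain ⟨Ly, hLy⟩ := exists_lipschitzOnWith_mu hγ_lip hγ (1 / 2) h.symm
    have hhalf : (1 / 2 : ℝ) ∈ Icc 0 1 := by norm_num
    have hW := (lipschitzOnWith_transportDist (⟨M, hM⟩ * Fintype.card V)).comp
      (hL.prodMk (hLx.prodMk hLy)) fun w hw =>
        have hγw := fun e => hγ (w e) ⟨hw.1 e, hw.2 e⟩
        ⟨wdist_mem_Icc hG hM fun e => ⟨hδ.le.trans (hw.1 e), hw.2 e⟩,
          mu_mem_stdSimplex hγw h hhalf, mu_mem_stdSimplex hγw h.symm hhalf⟩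
    have hd := ((LipschitzWith.eval y).comp (LipschitzWith.eval x)).comp_lipschitzOnWith hL
    refine exists_lipschitzOnWith_comp (g := fun p : ℝ × ℝ => 2 * (1 - p.1 / p.2)) isCompact_Icc
      (hW.prodMk hd) fun w hw => ?_
    have hpos := wdist_pos hG (fun e => hδ.trans_le (hw.1 e)) h
    exact contDiffAt_const.mul
      (contDiffAt_const.sub (ContDiffAt.div (by fun_prop) (by fun_prop) hpos.ne'))

end Lipschitz

section ODE

lemma hasDerivWithinAt_Ici_of_Icc {E : Type*} [NormedAddCommGroup E] [NormedSpace ℝ E] {f : ℝ → E}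
    {f' : E} {a b t : ℝ} (h : HasDerivWithinAt f f' (Icc a b) t) (ht : t ∈ Ico a b) :
    HasDerivWithinAt f f' (Ici t) t :=
  h.mono_of_mem_nhdsWithin
    (mem_of_superset (Icc_mem_nhdsGE ht.2) (Icc_subset_Icc_left ht.1))

lemma mul_exp_le_of_mul_le_deriv {f f' : ℝ → ℝ} {a b c : ℝ}
    (hf : ∀ t ∈ Icc a b, HasDerivWithinAt f (f' t) (Icc a b) t)
    (hf' : ∀ t ∈ Icc a b, c * f t ≤ f' t) :
    ∀ t ∈ Icc a b, f a * Real.exp (c * (t - a)) ≤ f t := by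
  intro t ht
  have hneg := le_gronwallBound_of_liminf_deriv_right_le (f := fun t => -f t)
    (f' := fun t => -f' t) (δ := -f a) (K := c) (ε := 0)
    (fun s hs => (hf s hs).continuousWithinAt.neg)
    (fun s hs r hr => (hasDerivWithinAt_Ici_of_Icc (hf s (Ico_subset_Icc_self hs))
      hs).fun_neg.liminf_right_slope_le hr)
    le_rfl (fun s hs => by linarith [hf' s (Ico_subset_Icc_self hs)]) t ht
  rw [gronwallBound_ε0] at hneg
  linarith

lemma exists_pos_le_of_continuousOn {α ι : Type*} [TopologicalSpace α] [Finite ι] {s : Set α}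
    {f : α → ι → ℝ} (hs : IsCompact s) (hf : ContinuousOn f s) (hpos : ∀ a ∈ s, ∀ i, 0 < f a i) :
    ∃ δ > 0, ∀ a ∈ s, ∀ i, δ ≤ f a i := by
  have hsmall : ∀ᶠ δ in 𝓝[>] (0 : ℝ), ∀ i, ∀ a ∈ s, δ ≤ f a i := by
    refine eventually_all.2 fun i => ?_
    obtain ⟨δ, hδ, hδf⟩ := hs.exists_forall_le' (continuousOn_pi.1 hf i) fun a ha => hpos a ha i
    filter_upwards [Ioc_mem_nhdsGT hδ] with ε hε a ha using hε.2.trans (hδf a ha)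
  obtain ⟨δ, hδ, hδf⟩ := (eventually_mem_nhdsWithin.and hsmall).exists
  exact ⟨δ, hδ, fun a ha i => hδf i a ha⟩

lemma mapsTo_of_trapped {E : Type*} [TopologicalSpace E] {X : ℝ → E} {U K : Set E} {T : ℝ}
    (hX : ContinuousOn X (Icc 0 T)) (hU : IsOpen U) (hK : IsClosed K) (hKU : K ⊆ U)
    (h0 : X 0 ∈ K) (htrap : ∀ τ ∈ Ioc 0 T, MapsTo X (Ico 0 τ) U → MapsTo X (Ico 0 τ) K) :
    MapsTo X (Icc 0 T) U := by
  by_contra hexit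
  obtain ⟨t, ht, htU⟩ : ∃ t ∈ Icc 0 T, X t ∉ U := by
    simpa only [MapsTo, not_forall, exists_prop] using hexit
  have hcompact : IsCompact (Icc 0 T ∩ X ⁻¹' Uᶜ) :=
    isCompact_Icc.of_isClosed_subset
      (hX.preimage_isClosed_of_isClosed isClosed_Icc hU.isClosed_compl) inter_subset_left
  obtain ⟨τ, ⟨hτ, hτU⟩, hmin⟩ := hcompact.exists_isLeast ⟨t, ht, htU⟩
  obtain rfl | hτ0 := hτ.1.eq_or_lt
  · exact hτU (hKU h0)
  have hbefore : MapsTo X (Ico 0 τ) U := fun t ht => by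
    by_contra htU
    exact (hmin ⟨⟨ht.1, ht.2.le.trans hτ.2⟩, htU⟩).not_gt ht.2
  have hclosure := (htrap τ ⟨hτ0, hτ.2⟩ hbefore).closure_of_continuousOn
    (hX.mono (by rw [closure_Ico hτ0.ne]; exact Icc_subset_Icc_right hτ.2))
  rw [closure_Ico hτ0.ne, hK.closure_eq] at hclosure
  exact hτU (hKU (hclosure ⟨hτ0.le, le_rfl⟩))

variable {ι E : Type*} [Fintype ι] [NormedAddCommGroup E] [NormedSpace ℝ E]

lemma exists_solution_of_bounded_lipschitz [CompleteSpace E] {F : E → E} {K L : NNReal} {T : ℝ}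
    (hF : LipschitzWith K F) (hL : ∀ x, ‖F x‖ ≤ L) (x₀ : E) (hT : 0 ≤ T) :
    ∃ X : ℝ → E, X 0 = x₀ ∧ ∀ t ∈ Icc 0 T, HasDerivWithinAt X (F (X t)) (Icc 0 T) t := by
  have hPL : IsPicardLindelof (fun _ => F) (⟨0, le_rfl, hT⟩ : Icc 0 T) x₀ (L * T.toNNReal) 0 L K :=
    .of_time_independent (fun x _ => hL x) hF.lipschitzOnWith (by simp [hT])
  exact hPL.exists_eq_forall_mem_Icc_hasDerivWithinAt₀

omit [NormedSpace ℝ E] in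
lemma exists_bounded_lipschitz_eqOn_Icc {F : (ι → ℝ) → E} {K : NNReal} {a b : ι → ℝ}
    (hF : LipschitzOnWith K F (Icc a b)) (hab : a ≤ b) :
    ∃ F' : (ι → ℝ) → E, (∃ K', LipschitzWith K' F') ∧ (∃ L : NNReal, ∀ w, ‖F' w‖ ≤ L) ∧
      EqOn F' F (Icc a b) := by
  let clamp (w : ι → ℝ) : ι → ℝ := fun i => projIcc (a i) (b i) (hab i) (w i)
  have hmaps : ∀ w, clamp w ∈ Icc a b := fun w =>
    ⟨fun i => (projIcc (a i) (b i) (hab i) (w i)).2.1,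
      fun i => (projIcc (a i) (b i) (hab i) (w i)).2.2⟩
  have hclamp : LipschitzWith 1 clamp := fun v w => edist_pi_le_iff.2 fun i =>
    ((LipschitzWith.projIcc (hab i)) (v i) (w i)).trans (by
      gcongr
      exact edist_le_pi_edist v w i)
  obtain ⟨L, hL⟩ := isCompact_Icc.exists_bound_of_continuousOn hF.continuousOn
  refine ⟨F ∘ clamp, ⟨K * 1, lipschitzOnWith_univ.1 (hF.comp hclamp.lipschitzOnWith
    fun w _ => hmaps w)⟩, ⟨L.toNNReal, fun w => (hL _ (hmaps w)).trans (Real.le_coe_toNNReal L)⟩,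
    fun w hw => congrArg F (funext fun i => ?_)⟩
  exact congrArg Subtype.val (projIcc_of_mem (hab i) ⟨hw.1 i, hw.2 i⟩)

omit [Fintype ι] in
lemma Icc_subset_interior_Icc [Finite ι] {a b c d : ι → ℝ} (hca : ∀ i, c i < a i)
    (hbd : ∀ i, b i < d i) : Icc a b ⊆ interior (Icc c d) := by
  rw [← pi_univ_Icc, ← pi_univ_Icc, interior_pi_set finite_univ]
  simp only [interior_Icc]
  exact pi_mono fun i _ => Icc_subset_Ioo (hca i) (hbd i)

lemma exists_trapped_solution {F : (ι → ℝ) → ι → ℝ} {C : NNReal} {a b x₀ : ι → ℝ}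
    {K : Set (ι → ℝ)} {T : ℝ} (hF : LipschitzOnWith C F (Icc a b)) (hK : IsClosed K)
    (hKab : K ⊆ interior (Icc a b)) (hx₀ : x₀ ∈ K) (hT : 0 ≤ T)
    (htrap : ∀ τ ∈ Ioc 0 T, ∀ X : ℝ → ι → ℝ, X 0 = x₀ → MapsTo X (Ico 0 τ) (Icc a b) →
      (∀ t ∈ Ico 0 τ, HasDerivWithinAt X (F (X t)) (Ico 0 τ) t) → MapsTo X (Ico 0 τ) K) :
    ∃ X : ℝ → ι → ℝ, X 0 = x₀ ∧ MapsTo X (Ico 0 T) (Icc a b) ∧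
      ∀ t ∈ Ico 0 T, HasDerivWithinAt X (F (X t)) (Ico 0 T) t := by
  have hx₀ab : x₀ ∈ Icc a b := interior_subset (hKab hx₀)
  obtain ⟨F', ⟨C', hC'⟩, ⟨L, hL⟩, hF'⟩ := exists_bounded_lipschitz_eqOn_Icc hF
    (hx₀ab.1.trans hx₀ab.2)
  obtain ⟨X, hX0, hX⟩ := exists_solution_of_bounded_lipschitz hC' hL x₀ hT
  have hsol : ∀ τ ≤ T, MapsTo X (Ico 0 τ) (Icc a b) →
      ∀ t ∈ Ico 0 τ, HasDerivWithinAt X (F (X t)) (Ico 0 τ) t := fun τ hτ hab t ht => by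
    rw [← hF' (hab ht)]
    exact (hX t ⟨ht.1, ht.2.le.trans hτ⟩).mono
      (Ico_subset_Icc_self.trans (Icc_subset_Icc_right hτ))
  have hstay : MapsTo X (Icc 0 T) (interior (Icc a b)) := by
    refine mapsTo_of_trapped (fun t ht => (hX t ht).continuousWithinAt) isOpen_interior hK hKab
      (hX0 ▸ hx₀) fun τ hτ hXτ => ?_
    have hab := hXτ.mono_right interior_subset
    exact htrap τ hτ X hX0 hab (hsol τ hτ.2 hab)
  have hab := hstay.mono Ico_subset_Icc_self interior_subset
  exact ⟨X, hX0, hab, hsol T le_rfl hab⟩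

/-- The replicator vector field with rates `k`, which has the shape of the right-hand side of the
normalized Ricci flow when `k` is the curvature. -/
def replicator (k w : ι → ℝ) : ι → ℝ :=
  fun e => -(k e) * w e + w e * ∑ h, k h * w h

lemma contDiff_replicator :
    ContDiff ℝ 1 fun p : (ι → ℝ) × (ι → ℝ) => replicator p.1 p.2 := by
  unfold replicator
  fun_prop

lemma exists_lipschitzOnWith_replicator {k : (ι → ℝ) → ι → ℝ} {K : NNReal} {s : Set (ι → ℝ)}
    (hs : IsCompact s) (hk : LipschitzOnWith K k s) :
    ∃ K', LipschitzOnWith K' (fun w => replicator (k w) w) s :=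
  exists_lipschitzOnWith_comp hs (hk.prodMk LipschitzWith.id.lipschitzOnWith)
    fun _ _ => contDiff_replicator.contDiffAt

lemma sum_replicator (k w : ι → ℝ) :
    ∑ e, replicator k w e = (∑ e, w e - 1) * ∑ h, k h * w h := by
  simp only [replicator, Finset.sum_add_distrib, ← Finset.sum_mul, neg_mul,
    Finset.sum_neg_distrib]
  ring

lemma sum_eq_one_of_hasDerivWithinAt_replicator {k X : ℝ → ι → ℝ} {C T : ℝ}
    (hX : ∀ t ∈ Icc 0 T, HasDerivWithinAt X (replicator (k t) (X t)) (Icc 0 T) t)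
    (hC : ∀ t ∈ Icc 0 T, ∑ h, k t h * X t h ≤ C) (h0 : ∑ e, X 0 e = 1) :
    ∀ t ∈ Icc 0 T, ∑ e, X t e = 1 := by
  intro t ht
  let defect (s : ℝ) : ℝ := -(∑ e, X s e - 1) ^ 2
  have hdefect : ∀ s ∈ Icc 0 T,
      HasDerivWithinAt defect (2 * (∑ h, k s h * X s h) * defect s) (Icc 0 T) s := fun s hs => by
    have hsum := HasDerivWithinAt.fun_sum (u := Finset.univ) fun e _ =>
      hasDerivWithinAt_pi.1 (hX s hs) e
    rw [sum_replicator] at hsum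
    refine ((hsum.sub_const 1).fun_pow 2).fun_neg.congr_deriv ?_
    simp only [defect]
    ring
  have hgronwall := mul_exp_le_of_mul_le_deriv (c := 2 * C) hdefect (fun s hs =>
    mul_le_mul_of_nonpos_right (by linarith [hC s hs]) (neg_nonpos.2 (sq_nonneg _))) t ht
  have hsq : (∑ e, X t e - 1) ^ 2 ≤ 0 := by
    simpa [defect, h0] using hgronwall
  linarith [pow_eq_zero_iff two_ne_zero |>.1 (hsq.antisymm (sq_nonneg _))]

end ODE

section Flow

variable {V : Type*} [Fintype V] {G : SimpleGraph V} [Fintype G.edgeSet] {γ : ℝ → ℝ}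
  {X₀ : G.edgeSet → ℝ} {X Y : ℝ → G.edgeSet → ℝ} {I J : Set ℝ} {δ T : ℝ}

omit [Fintype V] in
lemma le_one_of_sum_eq_one {w : G.edgeSet → ℝ} (hw : ∀ e, 0 ≤ w e) (hsum : ∑ e, w e = 1)
    (e : G.edgeSet) : w e ≤ 1 :=
  hsum ▸ Finset.single_le_sum (fun e _ => hw e) (Finset.mem_univ e)

lemma isRicciFlowOn_iff (hG : G.Connected) (hγ : ∀ r, 0 < r → 0 < γ r) :
    IsRicciFlowOn γ X₀ I X ↔ X 0 = X₀ ∧ (∀ t ∈ I, ∀ e, 0 < X t e) ∧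
      ∀ t ∈ I, HasDerivWithinAt X (replicator (curvature γ (X t)) (X t)) I t := by
  constructor
  · rintro ⟨hinit, hpos, κ, hκ⟩
    refine ⟨hinit, hpos, fun t ht => hasDerivWithinAt_pi.2 ?_⟩
    rw [← (isCurvature_iff hG (hpos t ht) fun e => hγ _ (hpos t ht e)).1 (hκ t ht).1]
    exact (hκ t ht).2
  · rintro ⟨hinit, hpos, hX⟩
    exact ⟨hinit, hpos, fun t => curvature γ (X t), fun t ht =>
      ⟨(isCurvature_iff hG (hpos t ht) fun e => hγ _ (hpos t ht e)).2 rfl,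
        hasDerivWithinAt_pi.1 (hX t ht)⟩⟩

namespace IsRicciFlowOn

lemma mono (hX : IsRicciFlowOn γ X₀ J X) (hIJ : I ⊆ J) : IsRicciFlowOn γ X₀ I X := by
  obtain ⟨hinit, hpos, κ, hκ⟩ := hX
  exact ⟨hinit, fun t ht => hpos t (hIJ ht), κ, fun t ht =>
    ⟨(hκ t (hIJ ht)).1, fun e => ((hκ t (hIJ ht)).2 e).mono hIJ⟩⟩

lemma continuousOn (hX : IsRicciFlowOn γ X₀ I X) : ContinuousOn X I := by
  obtain ⟨-, -, κ, hκ⟩ := hX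
  exact continuousOn_pi.2 fun e t ht => ((hκ t ht).2 e).continuousWithinAt

lemma sum_eq_one (hG : G.Connected) (hγ : ∀ r, 0 < r → 0 < γ r) (hX₀ : ∑ e, X₀ e = 1)
    (hX : IsRicciFlowOn γ X₀ (Icc 0 T) X) : ∀ t ∈ Icc 0 T, ∑ e, X t e = 1 := by
  obtain ⟨hinit, hpos, hderiv⟩ := (isRicciFlowOn_iff hG hγ).1 hX
  obtain ⟨C, hC⟩ := isCompact_Icc.bddAbove_image (f := fun t => ∑ e, 2 * X t e)
    (continuousOn_finsetSum _ fun e _ => (continuousOn_pi.1 hX.continuousOn e).const_mul 2)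
  refine sum_eq_one_of_hasDerivWithinAt_replicator (C := C) hderiv (fun t ht => ?_) (hinit ▸ hX₀)
  refine (Finset.sum_le_sum fun e _ => ?_).trans (hC (mem_image_of_mem _ ht))
  exact mul_le_mul_of_nonneg_right (curvature_le_two hG (fun e => (hpos t ht e).le)
    (fun e => hγ _ (hpos t ht e)) e) (hpos t ht e).le

lemma mem_Ioc (hG : G.Connected) (hγ : ∀ r, 0 < r → 0 < γ r) (hX₀ : ∑ e, X₀ e = 1)
    (hX : IsRicciFlowOn γ X₀ (Icc 0 T) X) : ∀ t ∈ Icc 0 T, ∀ e, X t e ∈ Ioc 0 1 := fun t ht e =>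
  ⟨hX.pos t ht e,
    le_one_of_sum_eq_one (fun e => (hX.pos t ht e).le) (hX.sum_eq_one hG hγ hX₀ t ht) e⟩

lemma eqOn_Icc (hG : G.Connected) (hγ : ∀ r, 0 < r → 0 < γ r)
    (hγ_lip : ∀ δ : ℝ, 0 < δ → ∃ K : NNReal, LipschitzOnWith K γ (Icc δ 1))
    (hX₀ : ∑ e, X₀ e = 1) (hX : IsRicciFlowOn γ X₀ (Icc 0 T) X)
    (hY : IsRicciFlowOn γ X₀ (Icc 0 T) Y) : EqOn X Y (Icc 0 T) := by
  obtain ⟨δX, hδX, hXδ⟩ := exists_pos_le_of_continuousOn isCompact_Icc hX.continuousOn hX.pos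
  obtain ⟨δY, hδY, hYδ⟩ := exists_pos_le_of_continuousOn isCompact_Icc hY.continuousOn hY.pos
  have hδ : 0 < min δX δY := lt_min hδX hδY
  obtain ⟨L, hL⟩ := hγ_lip _ hδ
  obtain ⟨L', hL'⟩ := exists_lipschitzOnWith_curvature hG hδ zero_le_one hL
    fun r hr => hγ r (hδ.trans_le hr.1)
  obtain ⟨K, hK⟩ := exists_lipschitzOnWith_replicator isCompact_Icc hL'
  obtain ⟨hX0, -, hX'⟩ := (isRicciFlowOn_iff hG hγ).1 hX
  obtain ⟨hY0, -, hY'⟩ := (isRicciFlowOn_iff hG hγ).1 hY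
  exact ODE_solution_unique_of_mem_Icc_right (fun _ _ => hK)
    hX.continuousOn
    (fun t ht => hasDerivWithinAt_Ici_of_Icc (hX' t (Ico_subset_Icc_self ht)) ht)
    (fun t ht => ⟨fun e => (min_le_left _ _).trans (hXδ t (Ico_subset_Icc_self ht) e),
      fun e => (hX.mem_Ioc hG hγ hX₀ t (Ico_subset_Icc_self ht) e).2⟩)
    hY.continuousOn
    (fun t ht => hasDerivWithinAt_Ici_of_Icc (hY' t (Ico_subset_Icc_self ht)) ht)
    (fun t ht => ⟨fun e => (min_le_right _ _).trans (hYδ t (Ico_subset_Icc_self ht) e),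
      fun e => (hY.mem_Ioc hG hγ hX₀ t (Ico_subset_Icc_self ht) e).2⟩)
    (hX0.trans hY0.symm)

lemma mul_exp_le (hG : G.Connected) (hγ : ∀ r, 0 < r → 0 < γ r) (hX₀ : ∑ e, X₀ e = 1)
    (hX : IsRicciFlowOn γ X₀ (Icc 0 T) X) (hexit : ∀ t ∈ Icc 0 T, ¬ ExitCondition (X t))
    {t : ℝ} (ht : t ∈ Icc 0 T) (e : G.edgeSet) :
    X₀ e * Real.exp (-(2 * (1 + Fintype.card G.edgeSet * Fintype.card V)) * t) ≤ X t e := by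
  obtain ⟨hinit, hpos, hderiv⟩ := (isRicciFlowOn_iff hG hγ).1 hX
  have hdecay := mul_exp_le_of_mul_le_deriv (f := fun t => X t e)
    (fun s hs => hasDerivWithinAt_pi.1 (hderiv s hs) e)
    (c := -(2 * (1 + Fintype.card G.edgeSet * Fintype.card V))) (fun s hs => ?_) t ht
  · simpa only [sub_zero, hinit] using hdecay
  have hγX := fun e => hγ _ (hpos s hs e)
  have hκ : curvature γ (X s) e ≤ 2 := curvature_le_two hG (fun e => (hpos s hs e).le) hγX e
  have hsum : -(2 * (Fintype.card G.edgeSet * Fintype.card V)) ≤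
      ∑ h, curvature γ (X s) h * X s h :=
    calc -(2 * (Fintype.card G.edgeSet * Fintype.card V) : ℝ)
        = ∑ _h : G.edgeSet, -(2 * (1 * Fintype.card V) : ℝ) := by
          rw [Finset.sum_const, Finset.card_univ, nsmul_eq_mul]
          ring
      _ ≤ _ := Finset.sum_le_sum fun h _ =>
          neg_le_curvature_mul hG hγX (hX.mem_Ioc hG hγ hX₀ s hs) (hexit s hs) h
  calc -(2 * (1 + Fintype.card G.edgeSet * Fintype.card V)) * X s e
      ≤ (-curvature γ (X s) e + ∑ h, curvature γ (X s) h * X s h) * X s e :=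
        mul_le_mul_of_nonneg_right (by linarith) (hpos s hs e).le
    _ = replicator (curvature γ (X s)) (X s) e := by
        simp only [replicator]
        ring

end IsRicciFlowOn

lemma exists_pos_le_of_not_exitCondition (hG : G.Connected) (hγ : ∀ r, 0 < r → 0 < γ r)
    (hX₀_pos : ∀ e, 0 < X₀ e) (hX₀ : ∑ e, X₀ e = 1) (hT : 0 ≤ T) :
    ∃ η > 0, (∀ e, η ≤ X₀ e) ∧ ∀ t ∈ Icc 0 T, ∀ X, IsRicciFlowOn γ X₀ (Icc 0 t) X →
      (∀ s ∈ Icc 0 t, ¬ ExitCondition (X s)) → ∀ e, η ≤ X t e := by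
  obtain ⟨η, hη, hηX₀⟩ := exists_pos_le_of_continuousOn (isCompact_Icc (a := 0) (b := T))
    (f := fun t e => X₀ e *
      Real.exp (-(2 * (1 + Fintype.card G.edgeSet * Fintype.card V)) * t))
    (by fun_prop) fun t _ e => mul_pos (hX₀_pos e) (Real.exp_pos _)
  exact ⟨η, hη, fun e => by simpa using hηX₀ 0 ⟨le_rfl, hT⟩ e, fun t ht X hX hexit e =>
    (hηX₀ t ht e).trans (hX.mul_exp_le hG hγ hX₀ hexit ⟨ht.1, le_rfl⟩ e)⟩

lemma isRicciFlowOn_Ico_of_eqOn (hG : G.Connected) (hγ : ∀ r, 0 < r → 0 < γ r)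
    (hX₀ : ∑ e, X₀ e = 1) {κ : (G.edgeSet → ℝ) → G.edgeSet → ℝ} (hκ : Continuous κ)
    (hκγ : EqOn κ (curvature γ) (Icc (fun _ => δ) fun _ => 1)) (hδ : 0 < δ) {M : ℝ}
    (hX0 : X 0 = X₀) (hXmem : MapsTo X (Ico 0 T) (Icc (fun _ => δ) fun _ => M))
    (hX : ∀ t ∈ Ico 0 T, HasDerivWithinAt X (replicator (κ (X t)) (X t)) (Ico 0 T) t) :
    IsRicciFlowOn γ X₀ (Ico 0 T) X := by
  obtain ⟨C, hC⟩ := isCompact_Icc.bddAbove_image (f := fun w => ∑ h, κ w h * w h)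
    (Continuous.continuousOn (by fun_prop))
  have hpos : ∀ t ∈ Ico 0 T, ∀ e, 0 < X t e := fun t ht e => hδ.trans_le ((hXmem ht).1 e)
  have hsum : ∀ t ∈ Ico 0 T, ∑ e, X t e = 1 := fun t ht => by
    have hsub : Icc 0 t ⊆ Ico 0 T := Icc_subset_Ico_right ht.2
    exact sum_eq_one_of_hasDerivWithinAt_replicator (fun s hs => (hX s (hsub hs)).mono hsub)
      (fun s hs => hC (mem_image_of_mem _ (hXmem (hsub hs)))) (hX0 ▸ hX₀) t ⟨ht.1, le_rfl⟩
  refine (isRicciFlowOn_iff hG hγ).2 ⟨hX0, hpos, fun t ht => ?_⟩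
  rw [← hκγ ⟨(hXmem ht).1, le_one_of_sum_eq_one (fun e => (hpos t ht e).le) (hsum t ht)⟩]
  exact hX t ht

lemma exists_isRicciFlowOn_Ico (hG : G.Connected) (hγ : ∀ r, 0 < r → 0 < γ r)
    (hγ_lip : ∀ δ : ℝ, 0 < δ → ∃ K : NNReal, LipschitzOnWith K γ (Icc δ 1))
    (hX₀_pos : ∀ e, 0 < X₀ e) (hX₀ : ∑ e, X₀ e = 1)
    (hexit : ∀ (T : ℝ) (X : ℝ → G.edgeSet → ℝ), 0 < T → IsRicciFlowOn γ X₀ (Ico 0 T) X →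
      ∀ t ∈ Ico 0 T, ¬ ExitCondition (X t)) (hT : 0 ≤ T) :
    ∃ X, IsRicciFlowOn γ X₀ (Ico 0 T) X := by
  obtain ⟨η, hη, hηX₀, hηX⟩ := exists_pos_le_of_not_exitCondition hG hγ hX₀_pos hX₀ hT
  obtain ⟨δ, hδ, hδη⟩ := exists_between hη
  obtain ⟨L, hL⟩ := hγ_lip δ hδ
  obtain ⟨L', hL'⟩ := exists_lipschitzOnWith_curvature hG hδ zero_le_one hL
    fun r hr => hγ r (hδ.trans_le hr.1)
  obtain ⟨κ, hκ, hκγ⟩ := hL'.extend_pi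
  obtain ⟨C, hC⟩ := exists_lipschitzOnWith_replicator isCompact_Icc hκ.lipschitzOnWith
  have hX₀_mem : X₀ ∈ Icc (fun _ => η) fun _ => 1 :=
    ⟨hηX₀, le_one_of_sum_eq_one (fun e => (hX₀_pos e).le) hX₀⟩
  have hflow : ∀ τ X, X 0 = X₀ → MapsTo X (Ico 0 τ) (Icc (fun _ => δ) fun _ => 2) →
      (∀ t ∈ Ico 0 τ, HasDerivWithinAt X (replicator (κ (X t)) (X t)) (Ico 0 τ) t) →
      IsRicciFlowOn γ X₀ (Ico 0 τ) X := fun τ X =>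
    isRicciFlowOn_Ico_of_eqOn hG hγ hX₀ hκ.continuous hκγ.symm hδ
  obtain ⟨X, hX0, hXmem, hX⟩ := exists_trapped_solution hC isClosed_Icc
    (Icc_subset_interior_Icc (fun _ => hδη) fun _ => one_lt_two) hX₀_mem hT
    fun τ hτ X hX0 hXmem hX t ht => by
      have hXτ := hflow τ X hX0 hXmem hX
      have hsub : Icc 0 t ⊆ Ico 0 τ := Icc_subset_Ico_right ht.2
      have ht0 : t ∈ Icc 0 t := ⟨ht.1, le_rfl⟩
      exact ⟨hηX t ⟨ht.1, ht.2.le.trans hτ.2⟩ X (hXτ.mono hsub) fun s hs =>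
        hexit τ X hτ.1 hXτ s (hsub hs), fun e => ((hXτ.mono hsub).mem_Ioc hG hγ hX₀ t ht0 e).2⟩
  exact ⟨X, hflow T X hX0 hXmem hX⟩

lemma exists_isRicciFlowOn_Ici (hG : G.Connected) (hγ : ∀ r, 0 < r → 0 < γ r)
    (hγ_lip : ∀ δ : ℝ, 0 < δ → ∃ K : NNReal, LipschitzOnWith K γ (Icc δ 1))
    (hX₀ : ∑ e, X₀ e = 1) (hlocal : ∀ T, 0 ≤ T → ∃ X, IsRicciFlowOn γ X₀ (Ico 0 T) X) :
    ∃ X, IsRicciFlowOn γ X₀ (Ici 0) X := by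
  choose! Z hZ using fun T (hT : 0 ≤ T) => hlocal (T + 1) (by positivity)
  have hglue : ∀ t ≥ 0, EqOn (fun s => Z s s) (Z t) (Ico 0 (t + 1)) := fun t ht s hs =>
    ((hZ s hs.1).mono (Icc_subset_Ico_right (lt_add_one s))).eqOn_Icc hG hγ hγ_lip hX₀
      ((hZ t ht).mono (Icc_subset_Ico_right hs.2)) ⟨hs.1, le_rfl⟩
  refine ⟨fun t => Z t t, (isRicciFlowOn_iff hG hγ).2 ⟨(hZ 0 le_rfl).init,
    fun t ht => (hZ t ht).pos t ⟨ht, lt_add_one t⟩, fun t ht => ?_⟩⟩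
  have ht' : t ∈ Ico 0 (t + 1) := ⟨ht, lt_add_one t⟩
  have hderiv := ((isRicciFlowOn_iff hG hγ).1 (hZ t ht)).2.2 t ht'
  refine (hderiv.congr (hglue t ht) rfl).mono_of_mem_nhdsWithin ?_
  rw [← Ici_inter_Iio]
  exact inter_mem self_mem_nhdsWithin (mem_nhdsWithin_of_mem_nhds (Iio_mem_nhds ht'.2))

end Flow

end RicciFlow

theorem theorem3p1 {V : Type*} [Fintype V] (G : SimpleGraph V) [Fintype G.edgeSet]
    (hG : G.Connected)
    (γ : ℝ → ℝ) (hγ_pos : ∀ x, 0 < x → 0 < γ x)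
    (hγ_lip : ∀ δ : ℝ, 0 < δ → ∃ K : NNReal, LipschitzOnWith K γ (Set.Icc δ 1))
    (X₀ : G.edgeSet → ℝ) (hX₀_pos : ∀ e, 0 < X₀ e) (hX₀_sum : ∑ e, X₀ e = 1)
    (hexit : ∀ (T : ℝ) (X : ℝ → G.edgeSet → ℝ), 0 < T →
      RicciFlow.IsRicciFlowOn γ X₀ (Set.Ico 0 T) X →
      ∀ t ∈ Set.Ico 0 T, ¬ RicciFlow.ExitCondition (X t)) :
    ∃ X : ℝ → G.edgeSet → ℝ, RicciFlow.IsRicciFlowOn γ X₀ (Set.Ici 0) X ∧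
      ∀ Y : ℝ → G.edgeSet → ℝ, RicciFlow.IsRicciFlowOn γ X₀ (Set.Ici 0) Y →
        Set.EqOn Y X (Set.Ici 0) := by
  obtain ⟨X, hX⟩ := RicciFlow.exists_isRicciFlowOn_Ici hG hγ_pos hγ_lip hX₀_sum fun T hT =>
    RicciFlow.exists_isRicciFlowOn_Ico hG hγ_pos hγ_lip hX₀_pos hX₀_sum hexit hT
  refine ⟨X, hX, fun Y hY t ht => ?_⟩
  exact (hY.mono Icc_subset_Ici_self).eqOn_Icc hG hγ_pos hγ_lip hX₀_sum
    (hX.mono Icc_subset_Ici_self) ⟨ht, le_rfl⟩
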